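/- Let $\mu>0$, $0<\delta\le 1$, $\rho_C>0$, $\theta_C>0$, $\eta>2$, $\sigma\in\mathbb R$, and let $k\ge 1$ be an integer. Consider a test cluster head (CH) at the origin of $\mathbb R^2$ and the following model of the D2D links. * The cluster members (CMs) scheduled on the frequency of the test link are located at the points $X_0,X_1,\dots$ of a homogeneous Poisson point process (PPP) of intensity $\delta\mu/k$. * The CHs around the $i$-th CM form a homogeneous PPP $Y_i=\{Y_{i,0},Y_{i,1},\dots\}$ of intensity $\delta\mu$, and $D_i=\inf_j\|X_i-Y_{i,j}\|$ is the distance from this CM to its closest CH. Spatial correlations between the transmit powers are ignored: the processes $Y_0,Y_1,\dots$ are independent of each other and of $(X_i)_i$. * Each CM uses full path-loss inversion, i.e. transmits with power $P_i=\rho_C D_i^{\eta}$. CM $i$ belongs to another cluster, and hence interferes, if and only if $D_i<\|X_i\|$. * The channel power gains $h_0,h_1,\dots$ of the interfering links and $h_*$ of the test link are exponentially distributed with mean one, and are independent of each other and of all the positions. The signal to interference and noise ratio of the test link is $$\Upsilon_C=\frac{\rho_C\,h_*}{\sigma^2+\sum_{i:\,D_i<\|X_i\|}P_i\,h_i\,\|X_i\|^{-\eta}}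 .$$ Then the D2D success probability $P_C=\mathbb P\{\Upsilon_C>\theta_C\}$ is $$P_C=\exp\left\{-\frac{\sigma^2\theta_C}{\rho_C}-\frac{2\,\theta_C}{k(\eta-2)}\;{}_2F_1\left(1,\,1-\frac2\eta;\,2-\frac2\eta;\,-\theta_C\right)\right\},$$ where ${}_2F_1$ is the Gaussian hypergeometric function, i.e. the analytic continuation of the hypergeometric series to $\mathbb C\setminus[1,\infty)$. In particular, for $\eta=4$, $$P_C=\exp\left\{-\frac{\sigma^2\theta_C}{\rho_C}-\frac{\sqrt{\theta_C}}{k}\arctan\sqrt{\theta_C}\right\}.$$ -/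

import Mathlib

open MeasureTheory ProbabilityTheory Set
open scoped ENNReal

noncomputable section

/-- The cut plane `ℂ \ [1, ∞)`. -/
def cutPlane : Set ℂ := {z | 1 - z ∈ Complex.slitPlane}

/-- `F` is holomorphic on `ℂ \ [1, ∞)` and is given on the unit disc by the hypergeometric
power series with parameters `a, b, c`. -/
def IsHypergeometricContinuation (a b c : ℂ) (F : ℂ → ℂ) : Prop :=
  DifferentiableOn ℂ F cutPlane ∧
    ∀ z ∈ Metric.ball (0 : ℂ) 1, F z = ordinaryHypergeometric a b c z

open Classical in
/-- The Gaussian hypergeometric function (principal branch): the analytic continuation of the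
hypergeometric series from the unit disc to `ℂ \ [1, ∞)`. -/
def gaussHypergeometric (a b c z : ℂ) : ℂ :=
  if h : ∃ F : ℂ → ℂ, IsHypergeometricContinuation a b c F then h.choose z else 0

theorem isOpen_cutPlane : IsOpen cutPlane :=
  Complex.isOpen_slitPlane.preimage (by fun_prop : Continuous fun z : ℂ => 1 - z)

theorem isPreconnected_cutPlane : IsPreconnected cutPlane := by
  have h : cutPlane = (fun w : ℂ => 1 - w) '' Complex.slitPlane := by
    ext z
    constructor
    · intro hz
      exact ⟨1 - z, hz, by ring⟩
    · rintro ⟨w, hw, rfl⟩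
      simpa [cutPlane] using hw
  rw [h]
  have hs : IsPreconnected Complex.slitPlane :=
    (Complex.starConvex_one_slitPlane.isPathConnected (Complex.one_mem_slitPlane)).isConnected.isPreconnected
  exact hs.image _ (by fun_prop)

/-- The continuation is unique, so that `gaussHypergeometric` is well defined on `ℂ \ [1, ∞)`. -/
theorem gaussHypergeometric_eq {a b c : ℂ} {F : ℂ → ℂ}
    (hF : IsHypergeometricContinuation a b c F) {z : ℂ} (hz : z ∈ cutPlane) :
    gaussHypergeometric a b c z = F z := by
  have h : ∃ F : ℂ → ℂ, IsHypergeometricContinuation a b c F := ⟨F, hF⟩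
  have hG := h.choose_spec
  simp only [gaussHypergeometric, dif_pos h]
  have h0 : (0 : ℂ) ∈ cutPlane := by simp [cutPlane]
  refine (hG.1.analyticOnNhd isOpen_cutPlane).eqOn_of_preconnected_of_eventuallyEq
    (hF.1.analyticOnNhd isOpen_cutPlane) isPreconnected_cutPlane h0 ?_ hz
  filter_upwards [Metric.ball_mem_nhds (0 : ℂ) one_pos] with w hw
  rw [hG.2 w hw, hF.2 w hw]

/-- The Euclidean plane. -/
abbrev Plane : Type := EuclideanSpace ℝ (Fin 2)

/-- The number of points of the sequence `x` that lie in `B`. -/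
def pointCount (x : ℕ → Plane) (B : Set Plane) : ℕ∞ := {i | x i ∈ B}.encard

/-- The random points `X 0, X 1, …` form a Poisson point process with intensity measure `Λ`:
the number of points in a set `B` of finite intensity is Poisson with mean `Λ B`, and the numbers
of points in disjoint sets are independent. -/
structure IsPoissonPointProcess {Ω : Type*} [MeasurableSpace Ω] (P : Measure Ω)
    (X : ℕ → Ω → Plane) (Λ : Measure Plane) : Prop where
  measurable : ∀ i, Measurable (X i)
  poisson : ∀ B : Set Plane, MeasurableSet B → Λ B ≠ ∞ → ∀ n : ℕ,
    P {ω | pointCount (fun i => X i ω) B = n} = poissonMeasure (Λ B).toNNReal {n}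
  indep : ∀ (m : ℕ) (B : Fin m → Set Plane), (∀ j, MeasurableSet (B j)) →
    Pairwise (fun j l => Disjoint (B j) (B l)) →
    iIndepFun (fun j ω => pointCount (fun i => X i ω) (B j)) P

/-- The homogeneous Poisson point process of the plane with intensity `a`. -/
def IsHomogeneousPPP {Ω : Type*} [MeasurableSpace Ω] (P : Measure Ω)
    (X : ℕ → Ω → Plane) (a : ℝ) : Prop :=
  IsPoissonPointProcess P X (ENNReal.ofReal a • (volume : Measure Plane))

/-- The D2D network seen by a test cluster head at the origin.
* `X i` are the positions of the cluster members scheduled on the frequency of the test link,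
  a Poisson point process of intensity `δ μ / k`;
* `Y i 0, Y i 1, …` are the cluster heads around the `i`-th of these members, a Poisson point
  process of intensity `δ μ`; correlations between different members are ignored, so that
  these processes are independent for different `i` and independent of the positions;
* `h i` is the power gain of the channel from the `i`-th member to the test cluster head and `h₀`
  the gain of the test link: independent exponential variables with mean one. -/
structure IsD2DNetwork {Ω : Type*} [MeasurableSpace Ω] (P : Measure Ω) (μ δ : ℝ) (k : ℕ)
    (X : ℕ → Ω → Plane) (Y : ℕ → ℕ → Ω → Plane) (h : ℕ → Ω → ℝ) (h₀ : Ω → ℝ) : Prop where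
  members : IsHomogeneousPPP P X (δ * μ / k)
  heads : ∀ i, IsHomogeneousPPP P (Y i) (δ * μ)
  measurable_gain : ∀ i, Measurable (h i)
  gain : ∀ i, P.map (h i) = expMeasure 1
  measurable_testGain : Measurable h₀
  testGain : P.map h₀ = expMeasure 1
  indep_heads : iIndepFun (fun i ω j => Y i j ω) P
  indep_gain : iIndepFun h P
  indep_heads_gain : IndepFun (fun ω i j => Y i j ω) (fun ω i => h i ω) P
  indep_members : IndepFun (fun ω i => X i ω) (fun ω => (fun i j => Y i j ω, fun i => h i ω)) P
  indep_testGain : IndepFun h₀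
    (fun ω => (fun i => X i ω, fun i j => Y i j ω, fun i => h i ω)) P

/-- Distance from a device at `x` to the closest of the cluster heads `y 0, y 1, …`. -/
def serviceDist (x : Plane) (y : ℕ → Plane) : ℝ := ⨅ j, dist x (y j)

/-- Transmit power under full path-loss inversion with target power `ρ`, path-loss exponent `η`
and service distance `r`. -/
def transmitPower (ρ η r : ℝ) : ℝ := ρ * r ^ η

/-- Aggregate inter-cluster interference at the origin. Member `i` belongs to another cluster, and
hence interferes, when it is closer to its own cluster head than to the one at the origin. -/
def interference (ρ η : ℝ) (x : ℕ → Plane) (y : ℕ → ℕ → Plane) (g : ℕ → ℝ) : ℝ≥0∞ :=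
  ∑' i, if serviceDist (x i) (y i) < ‖x i‖ then
    ENNReal.ofReal (transmitPower ρ η (serviceDist (x i) (y i)) * g i * ‖x i‖ ^ (-η)) else 0

/-- The SINR of the test link, whose mean received power is `ρ`; `N` is the noise power. It is
computed in `[0, ∞]`, so that infinite interference means SINR zero. -/
def sinr (ρ η N : ℝ) (x : ℕ → Plane) (y : ℕ → ℕ → Plane) (g : ℕ → ℝ) (g₀ : ℝ) : ℝ≥0∞ :=
  ENNReal.ofReal (ρ * g₀) / (ENNReal.ofReal N + interference ρ η x y g)

/-- The D2D success probability `ℙ(SINR > θ)`. -/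
def successProb {Ω : Type*} [MeasurableSpace Ω] (P : Measure Ω) (ρ η N θ : ℝ)
    (X : ℕ → Ω → Plane) (Y : ℕ → ℕ → Ω → Plane) (h : ℕ → Ω → ℝ) (h₀ : Ω → ℝ) : ℝ :=
  P.real {ω | ENNReal.ofReal θ <
    sinr ρ η N (fun i => X i ω) (fun i j => Y i j ω) (fun i => h i ω) (h₀ ω)}

end

/-! The gain `h₀` has tail exp(-s), so the success probability is the Laplace transform of noise
plus interference at θ/ρ (`measure_lt_sinr`). The noise is deterministic and factors out. The
interference is averaged in three layers, freezing independent data each time. An exponential gain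
with coefficient c contributes 1/(1+c). The service distances are independent, with a common law ν
that does not depend on the position of the member, so member i contributes the ν-mean of
1/(1+c(X_i, d)). The Laplace functional of the Poisson process of members then yields exp(-(δμ/k) ∫
(1 - mean) dx).

The coefficient is c(x,d) = θ(d/|x|)^η on d < |x|. Tonelli and the substitution x ↦ dx extract a
factor d², so ν enters only through E[D²] = 1/(πδμ), and the density δμ cancels. Polar coordinates
leave (2/k) θ ∫_1^∞ u^(1-η)/(1+θu^(-η)) du.

This integral, with -θ replaced by z and multiplied by η-2, is holomorphic on ℂ \ [1,∞), and its
geometric expansion in the unit disc is the required hypergeometric series. Uniqueness of the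
continuation identifies it at -θ, also for θ ≥ 1. For η = 4 an arctangent primitive is available. -/

open MeasureTheory ProbabilityTheory Set
open scoped ENNReal

noncomputable section

/-! ### Laplace transforms of `[0, ∞]`-valued variables -/

/-- The function `x ↦ exp (-x)` on `[0, ∞]`, with `exp (-∞) = 0`. -/
def expNeg (x : ℝ≥0∞) : ℝ≥0∞ := EReal.exp (-(x : EReal))

/-- The function `y ↦ -log y`, truncated below at zero: the inverse of `expNeg` on `[0, 1]`. -/
def negLog (y : ℝ≥0∞) : ℝ≥0∞ := (-ENNReal.log y).toENNReal

theorem continuous_expNeg : Continuous expNeg :=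
  ENNReal.continuous_exp.comp (continuous_neg.comp continuous_coe_ennreal_ereal)

theorem measurable_expNeg : Measurable expNeg := continuous_expNeg.measurable

theorem measurable_negLog : Measurable negLog :=
  (ENNReal.continuous_log.neg.measurable).ereal_toENNReal

theorem antitone_expNeg : Antitone expNeg := fun _ _ h =>
  EReal.exp_monotone (EReal.neg_le_neg_iff.2 (EReal.coe_ennreal_le_coe_ennreal_iff.2 h))

@[simp] theorem expNeg_zero : expNeg 0 = 1 := by simp [expNeg]

@[simp] theorem expNeg_top : expNeg ∞ = 0 := by simp [expNeg]

theorem expNeg_le_one (x : ℝ≥0∞) : expNeg x ≤ 1 := by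
  rw [← expNeg_zero]
  exact antitone_expNeg (zero_le)

theorem expNeg_add (x y : ℝ≥0∞) : expNeg (x + y) = expNeg x * expNeg y := by
  rw [expNeg, expNeg, expNeg, ← EReal.exp_add, EReal.coe_ennreal_add, EReal.neg_add, sub_eq_add_neg]
  · exact Or.inl (EReal.coe_ennreal_ne_bot x)
  · exact Or.inr (EReal.coe_ennreal_ne_bot y)

theorem expNeg_ofReal {x : ℝ} (hx : 0 ≤ x) :
    expNeg (ENNReal.ofReal x) = ENNReal.ofReal (Real.exp (-x)) := by
  rw [expNeg, EReal.coe_ennreal_ofReal, max_eq_left hx, ← EReal.coe_neg, EReal.exp_coe]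

/-- Since log y ≤ 0, the truncation in `negLog` loses nothing; y = 0 corresponds to ∞. This lets
infinite products of factors in [0, 1] be written as `expNeg` of a series that always makes sense.
-/
theorem expNeg_negLog {y : ℝ≥0∞} (hy : y ≤ 1) : expNeg (negLog y) = y := by
  have h : ENNReal.log y ≤ 0 := by
    have := ENNReal.log_monotone hy
    rwa [ENNReal.log_one] at this
  rw [expNeg, negLog, EReal.coe_toENNReal, neg_neg, ENNReal.exp_log]
  rwa [EReal.le_neg, neg_zero]

theorem expNeg_sum {ι : Type*} (s : Finset ι) (a : ι → ℝ≥0∞) :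
    expNeg (∑ i ∈ s, a i) = ∏ i ∈ s, expNeg (a i) := by
  classical
  induction s using Finset.induction_on with
  | empty => simp
  | insert i s hi ih => rw [Finset.sum_insert hi, Finset.prod_insert hi, expNeg_add, ih]

theorem expNeg_nat_mul (n : ℕ) (a : ℝ≥0∞) : expNeg (n * a) = expNeg a ^ n := by
  have := expNeg_sum (Finset.range n) (fun _ => a)
  simpa using this

theorem tendsto_prod_expNeg (a : ℕ → ℝ≥0∞) :
    Filter.Tendsto (fun n => ∏ i ∈ Finset.range n, expNeg (a i)) Filter.atTop
      (nhds (expNeg (∑' i, a i))) := by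
  simp_rw [← expNeg_sum]
  exact (continuous_expNeg.tendsto _).comp (ENNReal.tendsto_nat_tsum a)

theorem lintegral_expNeg_le_one {Ω : Type*} [MeasurableSpace Ω] (P : Measure Ω)
    [IsProbabilityMeasure P] (Z : Ω → ℝ≥0∞) : ∫⁻ ω, expNeg (Z ω) ∂P ≤ 1 := by
  calc ∫⁻ ω, expNeg (Z ω) ∂P ≤ ∫⁻ _, 1 ∂P := lintegral_mono fun _ => expNeg_le_one _
    _ = 1 := by simp

/-- The Laplace transform of a series of independent nonnegative variables. -/
theorem lintegral_expNeg_tsum {Ω : Type*} [MeasurableSpace Ω] {P : Measure Ω}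
    {Z : ℕ → Ω → ℝ≥0∞} (hZ : ∀ i, Measurable (Z i)) (hind : iIndepFun Z P) :
    ∫⁻ ω, expNeg (∑' i, Z i ω) ∂P = expNeg (∑' i, negLog (∫⁻ ω, expNeg (Z i ω) ∂P)) := by
  have : IsProbabilityMeasure P := hind.isProbabilityMeasure
  have h1 : Filter.Tendsto (fun n => ∫⁻ ω, ∏ i ∈ Finset.range n, expNeg (Z i ω) ∂P) Filter.atTop
      (nhds (∫⁻ ω, expNeg (∑' i, Z i ω) ∂P)) := by
    refine tendsto_lintegral_of_dominated_convergence (fun _ => 1) (fun n => ?_) (fun n => ?_)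
      (by simp) (.of_forall fun ω => tendsto_prod_expNeg _)
    · exact Finset.measurable_fun_prod _ fun i _ => measurable_expNeg.comp (hZ i)
    · exact .of_forall fun ω => Finset.prod_le_one' fun i _ => expNeg_le_one _
  refine tendsto_nhds_unique h1 ?_
  convert tendsto_prod_expNeg _ using 2 with n
  rw [lintegral_prod_eq_prod_lintegral_of_indepFun _ (fun i ω => expNeg (Z i ω))
    (hind.comp (fun _ => expNeg) (fun _ => measurable_expNeg))
    (fun i => measurable_expNeg.comp (hZ i))]
  refine Finset.prod_congr rfl fun i _ => (expNeg_negLog ?_).symm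
  exact lintegral_expNeg_le_one P _

/-- Fubini for the joint law, which is a product by independence. Stated on Ω itself, it serves as
conditioning: A is frozen while B is averaged. -/
theorem ProbabilityTheory.IndepFun.lintegral_eq_lintegral_lintegral {Ω α β : Type*}
    [MeasurableSpace Ω]
    [MeasurableSpace α] [MeasurableSpace β] {P : Measure Ω} [IsProbabilityMeasure P]
    {A : Ω → α} {B : Ω → β} (hA : Measurable A) (hB : Measurable B) (hAB : IndepFun A B P)
    {F : α → β → ℝ≥0∞} (hF : Measurable (Function.uncurry F)) :
    ∫⁻ ω, F (A ω) (B ω) ∂P = ∫⁻ ω, ∫⁻ ω', F (A ω) (B ω') ∂P ∂P := by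
  have : IsProbabilityMeasure (P.map B) := Measure.isProbabilityMeasure_map hB.aemeasurable
  have h := hAB.map_prod_eq_prod_map_map hA.aemeasurable hB.aemeasurable
  calc ∫⁻ ω, F (A ω) (B ω) ∂P = ∫⁻ z, Function.uncurry F z ∂(P.map fun ω => (A ω, B ω)) := by
        rw [lintegral_map hF (hA.prodMk hB)]; rfl
    _ = ∫⁻ a, ∫⁻ b, F a b ∂(P.map B) ∂(P.map A) := by
        rw [h, lintegral_prod _ hF.aemeasurable]; rfl
    _ = ∫⁻ ω, ∫⁻ b, F (A ω) b ∂(P.map B) ∂P := by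
        exact lintegral_map hF.lintegral_prod_right' hA
    _ = _ := by
        refine lintegral_congr fun ω => ?_
        exact lintegral_map (hF.comp measurable_prodMk_left) hB

/-! ### The Laplace functional of a Poisson point process -/

theorem pointCount_eq_tsum (x : ℕ → Plane) (B : Set Plane) :
    ((pointCount x B : ℕ∞) : ℝ≥0∞) = ∑' i, B.indicator 1 (x i) := by
  rw [pointCount, ← ENNReal.tsum_set_one, tsum_subtype {i | x i ∈ B} (fun _ => (1 : ℝ≥0∞))]
  rfl

theorem measurable_pointCount {Ω : Type*} [MeasurableSpace Ω] {X : ℕ → Ω → Plane}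
    (hX : ∀ i, Measurable (X i)) {B : Set Plane} (hB : MeasurableSet B) :
    Measurable fun ω => pointCount (fun i => X i ω) B := by
  have h : Measurable fun ω => ((pointCount (fun i => X i ω) B : ℕ∞) : ℝ≥0∞) := by
    simp_rw [pointCount_eq_tsum]
    exact Measurable.tsum fun i =>
      (measurable_one.indicator hB : Measurable (B.indicator (1 : Plane → ℝ≥0∞))).comp (hX i)
  refine measurable_to_countable' fun n => ?_
  have : (fun ω => pointCount (fun i => X i ω) B) ⁻¹' {n} =
      (fun ω => ((pointCount (fun i => X i ω) B : ℕ∞) : ℝ≥0∞)) ⁻¹' {(n : ℝ≥0∞)} := by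
    ext ω
    simp
  rw [this]
  exact h (measurableSet_singleton _)

/-- The Poisson generating function, from the exponential series. The case q = 1 also gives total
mass one. -/
theorem lintegral_pow_poissonMeasure (r : NNReal) (q : ℝ≥0∞) (hq : q ≤ 1) :
    ∑' n : ℕ, q ^ n * poissonMeasure r {n} = expNeg (r * (1 - q)) := by
  lift q to NNReal using ne_top_of_le_ne_top ENNReal.one_ne_top hq
  have hq' : (q : ℝ) ≤ 1 := by exact_mod_cast hq
  have h1 : ∀ n : ℕ, (q : ℝ≥0∞) ^ n * poissonMeasure r {n} =
      ENNReal.ofReal (Real.exp (-r) * ((r * q : ℝ) ^ n / n.factorial)) := by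
    intro n
    rw [poissonMeasure_singleton, ← ENNReal.ofReal_coe_nnreal, ← ENNReal.ofReal_pow (by positivity),
      ← ENNReal.ofReal_mul (by positivity)]
    congr 1
    ring
  have h2 : HasSum (fun n : ℕ => Real.exp (-r) * ((r * q : ℝ) ^ n / n.factorial))
      (Real.exp (-r) * Real.exp (r * q)) := by
    rw [Real.exp_eq_exp_ℝ]
    exact (NormedSpace.expSeries_div_hasSum_exp (r * q : ℝ)).mul_left _
  simp_rw [h1]
  rw [← ENNReal.ofReal_tsum_of_nonneg (fun n => by positivity) h2.summable, h2.tsum_eq,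
    ← Real.exp_add]
  have : (r : ℝ≥0∞) * (1 - q) = ENNReal.ofReal ((r : ℝ) * (1 - (q : ℝ))) := by
    rw [ENNReal.ofReal_mul r.coe_nonneg, ENNReal.ofReal_sub _ q.coe_nonneg, ENNReal.ofReal_coe_nnreal,
      ENNReal.ofReal_coe_nnreal, ENNReal.ofReal_one]
  rw [this, expNeg_ofReal (mul_nonneg r.coe_nonneg (sub_nonneg.2 hq'))]
  congr 2
  ring

namespace IsPoissonPointProcess

variable {Ω : Type*} [MeasurableSpace Ω] {P : Measure Ω} {X : ℕ → Ω → Plane} {Λ : Measure Plane}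

theorem lintegral_expNeg_pointCount (hX : IsPoissonPointProcess P X Λ) [IsProbabilityMeasure P]
    {B : Set Plane} (hB : MeasurableSet B) (hΛ : Λ B ≠ ∞) (c : ℝ≥0∞) :
    ∫⁻ ω, expNeg ((pointCount (fun i => X i ω) B : ℕ∞) * c) ∂P =
      expNeg (Λ B * (1 - expNeg c)) := by
  have hm := measurable_pointCount hX.measurable hB
  have hms : ∀ n : ℕ, MeasurableSet {ω | pointCount (fun i => X i ω) B = n} := fun n =>
    hm (measurableSet_singleton (n : ℕ∞))
  -- The probabilities of the finite values already sum to one, so the count is almost surely finite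
  -- and Ω may be split according to its value.
  have hsum : ∑' n : ℕ, P {ω | pointCount (fun i => X i ω) B = n} = 1 := by
    simp_rw [hX.poisson B hB hΛ]
    simpa using lintegral_pow_poissonMeasure (Λ B).toNNReal 1 le_rfl
  have hdisj : Pairwise (Function.onFun Disjoint
      fun n : ℕ => {ω | pointCount (fun i => X i ω) B = n}) := by
    intro m n hmn
    refine Set.disjoint_left.2 fun ω h1 h2 => hmn ?_
    have : (m : ℕ∞) = n := by rw [← h1, ← h2]
    exact_mod_cast this
  have hU : ∀ᵐ ω ∂P, ω ∈ ⋃ n : ℕ, {ω | pointCount (fun i => X i ω) B = n} := by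
    refine (mem_ae_iff_prob_eq_one (MeasurableSet.iUnion hms)).2 ?_
    rw [measure_iUnion hdisj hms, hsum]
  rw [← Measure.restrict_eq_self_of_ae_mem hU, lintegral_iUnion hms hdisj]
  have : ∀ n : ℕ, ∫⁻ ω in {ω | pointCount (fun i => X i ω) B = n},
      expNeg ((pointCount (fun i => X i ω) B : ℕ∞) * c) ∂P =
      expNeg c ^ n * poissonMeasure (Λ B).toNNReal {n} := by
    intro n
    rw [setLIntegral_congr_fun (hms n) (g := fun _ => expNeg c ^ n), setLIntegral_const,
      hX.poisson B hB hΛ]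
    intro ω hω
    simp only [mem_ofPred_eq] at hω
    simp only [hω]
    rw [ENat.toENNReal_coe, expNeg_nat_mul]
  simp_rw [this]
  rw [lintegral_pow_poissonMeasure _ _ (expNeg_le_one c), ENNReal.coe_toNNReal hΛ]

/-- The sum is a combination of the counts in the disjoint level sets of f. These counts are
independent, so the transform is a product of Poisson transforms. -/
theorem lintegral_expNeg_tsum_simpleFunc (hX : IsPoissonPointProcess P X Λ)
    [IsProbabilityMeasure P] (f : SimpleFunc Plane ℝ≥0∞) (hf : Λ (Function.support f) ≠ ∞) :
    ∫⁻ ω, expNeg (∑' i, f (X i ω)) ∂P = expNeg (∫⁻ x, 1 - expNeg (f x) ∂Λ) := by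
  classical
  -- The value 0 is dropped because its level set may have infinite intensity; the other level sets
  -- lie in the support.
  let s := f.range.erase 0
  let B : Fin s.card → Set Plane := fun j => f ⁻¹' {((s.equivFin.symm j : s) : ℝ≥0∞)}
  let c : Fin s.card → ℝ≥0∞ := fun j => (s.equivFin.symm j : s)
  have hc : ∀ j, c j ≠ 0 := fun j => (Finset.mem_erase.1 (s.equivFin.symm j).2).1
  have hB : ∀ j, MeasurableSet (B j) := fun j => f.measurableSet_fiber _
  have hΛ : ∀ j, Λ (B j) ≠ ∞ := fun j => ne_top_of_le_ne_top hf <| measure_mono fun x hx => by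
    rw [Function.mem_support, show f x = c j from hx]
    exact hc j
  have hdisj : Pairwise fun j l => Disjoint (B j) (B l) := by
    intro j l hjl
    refine Set.disjoint_left.2 fun x h1 h2 => hjl ?_
    have : c j = c l := (show f x = c j from h1).symm.trans h2
    exact s.equivFin.symm.injective (Subtype.ext this)
  have hrep : ∀ (g : ℝ≥0∞ → ℝ≥0∞), g 0 = 0 → ∀ x,
      g (f x) = ∑ j, (B j).indicator 1 x * g (c j) := by
    intro g hg x
    by_cases hx : f x = 0
    · rw [hx, hg, Finset.sum_eq_zero]
      intro j _
      rw [indicator_of_notMem, zero_mul]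
      intro h
      exact hc j ((show f x = c j from h).symm.trans hx)
    · have hmem : f x ∈ s := Finset.mem_erase.2 ⟨hx, f.mem_range_self x⟩
      have hcx : c (s.equivFin ⟨f x, hmem⟩) = f x := by simp [c]
      rw [Finset.sum_eq_single (s.equivFin ⟨f x, hmem⟩), indicator_of_mem, hcx]
      · simp
      · exact hcx.symm
      · intro j _ hj
        rw [indicator_of_notMem, zero_mul]
        intro h
        apply hj
        have : s.equivFin.symm j = ⟨f x, hmem⟩ := Subtype.ext (show f x = c j from h).symm
        rw [← this, Equiv.apply_symm_apply]
      · simp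
  have h1 : ∀ ω, expNeg (∑' i, f (X i ω)) =
      ∏ j, expNeg ((pointCount (fun i => X i ω) (B j) : ℕ∞) * c j) := by
    intro ω
    rw [← expNeg_sum]
    congr 1
    simp_rw [pointCount_eq_tsum, ← ENNReal.tsum_mul_right]
    rw [← Summable.tsum_finsetSum fun _ _ => ENNReal.summable]
    exact tsum_congr fun i => hrep id rfl _
  simp_rw [h1]
  rw [lintegral_prod_eq_prod_lintegral_of_indepFun _
    (fun j ω => expNeg ((pointCount (fun i => X i ω) (B j) : ℕ∞) * c j))
    ((hX.indep _ B hB hdisj).comp (fun j n => expNeg ((n : ℝ≥0∞) * c j))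
      (fun j => measurable_from_top))
    (fun j => (measurable_from_top (f := fun n : ℕ∞ => expNeg ((n : ℝ≥0∞) * c j))).comp
      (measurable_pointCount hX.measurable (hB j)))]
  simp_rw [hX.lintegral_expNeg_pointCount (hB _) (hΛ _)]
  rw [← expNeg_sum]
  congr 1
  simp_rw [hrep (fun a => 1 - expNeg a) (by simp)]
  rw [lintegral_finsetSum]
  · refine Finset.sum_congr rfl fun j _ => ?_
    rw [lintegral_mul_const _ (measurable_one.indicator (hB j)), lintegral_indicator_one (hB j)]
  · exact fun j _ => (measurable_one.indicator (hB j)).mul_const _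

/-- The Laplace functional of a Poisson point process. -/
theorem lintegral_expNeg_tsum (hX : IsPoissonPointProcess P X Λ) [IsProbabilityMeasure P]
    [SigmaFinite Λ] {f : Plane → ℝ≥0∞} (hf : Measurable f) :
    ∫⁻ ω, expNeg (∑' i, f (X i ω)) ∂P = expNeg (∫⁻ x, 1 - expNeg (f x) ∂Λ) := by
  -- Simple functions increasing to f, cut off to sets of finite intensity so that the simple case
  -- applies.
  let g : ℕ → SimpleFunc Plane ℝ≥0∞ := fun n =>
    (SimpleFunc.eapprox f n).restrict (spanningSets Λ n)
  have hgapp : ∀ n x, g n x = (spanningSets Λ n).indicator (SimpleFunc.eapprox f n) x := fun n x =>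
    SimpleFunc.restrict_apply _ (measurableSet_spanningSets Λ n) x
  have hgm : ∀ x, Monotone fun n => g n x := by
    intro x m n hmn
    simp only [hgapp]
    exact (indicator_le_indicator_of_subset (monotone_spanningSets Λ hmn) (fun _ => zero_le) x).trans
      (indicator_le_indicator (SimpleFunc.monotone_eapprox f hmn x))
  have hglim : ∀ x, Filter.Tendsto (fun n => g n x) Filter.atTop (nhds (f x)) := by
    intro x
    have h1 : Filter.Tendsto (fun n => SimpleFunc.eapprox f n x) Filter.atTop (nhds (f x)) := by
      rw [← SimpleFunc.iSup_eapprox_apply hf x]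
      exact tendsto_atTop_iSup fun m n h => SimpleFunc.monotone_eapprox f h x
    refine h1.congr' ?_
    filter_upwards [Filter.eventually_ge_atTop (spanningSetsIndex Λ x)] with n hn
    rw [hgapp, indicator_of_mem]
    exact monotone_spanningSets Λ hn (mem_spanningSetsIndex Λ x)
  have hgsup : ∀ x, ⨆ n, g n x = f x := fun x =>
    tendsto_nhds_unique (tendsto_atTop_iSup (hgm x)) (hglim x)
  have hL : Filter.Tendsto (fun n => ∫⁻ ω, expNeg (∑' i, g n (X i ω)) ∂P) Filter.atTop
      (nhds (∫⁻ ω, expNeg (∑' i, f (X i ω)) ∂P)) := by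
    refine tendsto_lintegral_of_dominated_convergence (fun _ => 1) (fun n => ?_) (fun n => ?_)
      (by simp) (.of_forall fun ω => ?_)
    · exact measurable_expNeg.comp
        (Measurable.tsum fun i => (g n).measurable.comp (hX.measurable i))
    · exact .of_forall fun ω => expNeg_le_one _
    · refine (continuous_expNeg.tendsto _).comp ?_
      have : ∑' i, f (X i ω) = ⨆ n, ∑' i, g n (X i ω) := by
        simp_rw [← hgsup, ← lintegral_count]
        exact lintegral_iSup (fun n => measurable_from_top) fun m n h i => hgm _ h
      rw [this]
      exact tendsto_atTop_iSup fun m n h => ENNReal.tsum_le_tsum fun i => hgm _ h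
  have hR : Filter.Tendsto (fun n => expNeg (∫⁻ x, 1 - expNeg (g n x) ∂Λ)) Filter.atTop
      (nhds (expNeg (∫⁻ x, 1 - expNeg (f x) ∂Λ))) := by
    refine (continuous_expNeg.tendsto _).comp ?_
    refine lintegral_tendsto_of_tendsto_of_monotone
      (fun n => (measurable_const.sub (measurable_expNeg.comp (g n).measurable)).aemeasurable)
      (.of_forall fun x m n h => tsub_le_tsub_left (antitone_expNeg (hgm x h)) 1)
      (.of_forall fun x => ?_)
    exact ENNReal.Tendsto.sub tendsto_const_nhds ((continuous_expNeg.tendsto _).comp (hglim x))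
      (Or.inl ENNReal.one_ne_top)
  refine tendsto_nhds_unique hL (hR.congr fun n => ?_)
  rw [hX.lintegral_expNeg_tsum_simpleFunc]
  refine ne_top_of_le_ne_top (measure_spanningSets_lt_top Λ n).ne (measure_mono fun x hx => ?_)
  by_contra h
  rw [Function.mem_support, hgapp, indicator_of_notMem h] at hx
  exact hx rfl

end IsPoissonPointProcess

/-! ### The exponential distribution -/

/-- Allowing s = ∞ covers the event of infinite interference, where both sides vanish. -/
theorem expMeasure_lt_ofReal (s : ℝ≥0∞) :
    expMeasure 1 {g | s < ENNReal.ofReal g} = expNeg s := by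
  have : IsProbabilityMeasure (expMeasure 1) := isProbabilityMeasure_expMeasure one_pos
  rcases eq_or_ne s ∞ with rfl | hs
  · simp
  lift s to NNReal using hs
  have h : {g : ℝ | (s : ℝ≥0∞) < ENNReal.ofReal g} = (Iic (s : ℝ))ᶜ := by
    ext g
    rw [mem_ofPred_eq, compl_Iic, mem_Ioi, ← ENNReal.ofReal_coe_nnreal,
      ENNReal.ofReal_lt_ofReal_iff_of_nonneg s.coe_nonneg]
  rw [h, prob_compl_eq_one_sub measurableSet_Iic, ← ofReal_cdf, cdf_expMeasure_eq one_pos,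
    if_pos s.coe_nonneg, ← ENNReal.ofReal_one, ← ENNReal.ofReal_sub, ← ENNReal.ofReal_coe_nnreal,
    expNeg_ofReal s.coe_nonneg]
  · simp
  · simp

theorem lintegral_expNeg_mul_expMeasure {c : ℝ} (hc : 0 ≤ c) :
    ∫⁻ g, expNeg (ENNReal.ofReal (c * g)) ∂expMeasure 1 = ENNReal.ofReal (1 / (1 + c)) := by
  have hm : Measurable (gammaPDF 1 1) := (measurable_gammaPDFReal 1 1).ennreal_ofReal
  rw [expMeasure, gammaMeasure, lintegral_withDensity_eq_lintegral_mul _ hm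
    (g := fun g => expNeg (ENNReal.ofReal (c * g))) (measurable_expNeg.comp (by fun_prop))]
  have h : ∀ g : ℝ, (gammaPDF 1 1 * fun g => expNeg (ENNReal.ofReal (c * g))) g =
      (Ici 0).indicator (fun g => ENNReal.ofReal (Real.exp (-(1 + c) * g))) g := by
    intro g
    rw [Pi.mul_apply, show gammaPDF 1 1 g = exponentialPDF 1 g from rfl]
    by_cases hg : 0 ≤ g
    · rw [indicator_of_mem (mem_Ici.2 hg), exponentialPDF_of_nonneg hg,
        expNeg_ofReal (mul_nonneg hc hg), ← ENNReal.ofReal_mul (by positivity), one_mul, one_mul,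
        ← Real.exp_add]
      congr 2
      ring
    · rw [indicator_of_notMem (by simpa using hg), exponentialPDF_of_neg (not_le.1 hg), zero_mul]
  simp_rw [h]
  have hneg : -(1 + c) < 0 := by linarith
  rw [lintegral_indicator measurableSet_Ici, setLIntegral_congr Ioi_ae_eq_Ici.symm,
    ← ofReal_integral_eq_lintegral_ofReal (integrableOn_exp_mul_Ioi hneg 0)
      (.of_forall fun _ => (Real.exp_pos _).le), integral_exp_mul_Ioi hneg]
  congr 1
  rw [mul_zero, Real.exp_zero, neg_div_neg_eq]

/-! ### The service distance -/

theorem serviceDist_nonneg (x : Plane) (y : ℕ → Plane) : 0 ≤ serviceDist x y :=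
  Real.iInf_nonneg fun _ => dist_nonneg

theorem measurable_serviceDist :
    Measurable fun p : Plane × (ℕ → Plane) => serviceDist p.1 p.2 :=
  Measurable.iInf fun j => measurable_fst.dist ((measurable_pi_apply j).comp measurable_snd)

/-- The open ball is the right one: an infimum is at least r exactly when no term is below r,
whether or not it is attained. The law of the service distance thus reduces to void probabilities.
-/
theorem le_serviceDist_iff {x : Plane} {y : ℕ → Plane} {r : ℝ} :
    r ≤ serviceDist x y ↔ pointCount y (Metric.ball x r) = 0 := by
  have hb : BddBelow (range fun j => dist x (y j)) := ⟨0, by rintro _ ⟨j, rfl⟩; exact dist_nonneg⟩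
  rw [serviceDist, le_ciInf_iff hb, pointCount, Set.encard_eq_zero, Set.eq_empty_iff_forall_notMem]
  simp [dist_comm x]

theorem IsHomogeneousPPP.isProbabilityMeasure {Ω : Type*} [MeasurableSpace Ω] {P : Measure Ω}
    {Y : ℕ → Ω → Plane} {a : ℝ} (hY : IsHomogeneousPPP P Y a) : IsProbabilityMeasure P :=
  (hY.indep 1 (fun _ => ∅) (by simp) (by intro i j; simp)).isProbabilityMeasure

theorem IsHomogeneousPPP.measure_le_serviceDist {Ω : Type*} [MeasurableSpace Ω] {P : Measure Ω}
    {Y : ℕ → Ω → Plane} {a : ℝ} (hY : IsHomogeneousPPP P Y a) (x : Plane) (r : ℝ) :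
    P {ω | r ≤ serviceDist x (fun j => Y j ω)} =
      expNeg (ENNReal.ofReal a * (ENNReal.ofReal r ^ 2 * ENNReal.ofReal Real.pi)) := by
  have hv : (ENNReal.ofReal a • (volume : Measure Plane)) (Metric.ball x r) =
      ENNReal.ofReal a * (ENNReal.ofReal r ^ 2 * ENNReal.ofReal Real.pi) := by
    rw [Measure.smul_apply, EuclideanSpace.volume_ball_fin_two, smul_eq_mul]
  have hfin : (ENNReal.ofReal a • (volume : Measure Plane)) (Metric.ball x r) ≠ ∞ := by
    rw [hv]
    finiteness
  have h := hY.poisson (Metric.ball x r) measurableSet_ball hfin 0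
  simp_rw [le_serviceDist_iff]
  rw [← hv]
  refine h.trans ?_
  rw [poissonMeasure_singleton]
  conv_rhs => rw [← ENNReal.coe_toNNReal hfin, ← ENNReal.ofReal_coe_nnreal,
    expNeg_ofReal NNReal.zero_le_coe]
  simp

theorem IsHomogeneousPPP.measurable_serviceDist {Ω : Type*} [MeasurableSpace Ω] {P : Measure Ω}
    {Y : ℕ → Ω → Plane} {a : ℝ} (hY : IsHomogeneousPPP P Y a) (x : Plane) :
    Measurable fun ω => serviceDist x (fun j => Y j ω) :=
  Measurable.iInf fun j => measurable_const.dist (IsPoissonPointProcess.measurable hY j)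

/-- The law of the service distance depends neither on the device nor on the realization of the
Poisson process. -/
theorem IsHomogeneousPPP.map_serviceDist_eq {Ω : Type*} [MeasurableSpace Ω] {P : Measure Ω}
    {Y Y' : ℕ → Ω → Plane} {a : ℝ} (hY : IsHomogeneousPPP P Y a) (hY' : IsHomogeneousPPP P Y' a)
    (x x' : Plane) :
    P.map (fun ω => serviceDist x (fun j => Y j ω)) =
      P.map (fun ω => serviceDist x' (fun j => Y' j ω)) := by
  have := hY.isProbabilityMeasure
  have := Measure.isProbabilityMeasure_map (μ := P) (hY.measurable_serviceDist x).aemeasurable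
  refine Measure.ext_of_Ici _ _ fun r => ?_
  rw [Measure.map_apply (hY.measurable_serviceDist x) measurableSet_Ici,
    Measure.map_apply (hY'.measurable_serviceDist x') measurableSet_Ici]
  exact (hY.measure_le_serviceDist x r).trans (hY'.measure_le_serviceDist x' r).symm

/-- The second moment of the service distance. -/
theorem IsHomogeneousPPP.lintegral_serviceDist_sq {Ω : Type*} [MeasurableSpace Ω] {P : Measure Ω}
    {Y : ℕ → Ω → Plane} {a : ℝ} (ha : 0 < a) (hY : IsHomogeneousPPP P Y a) (x : Plane) :
    ∫⁻ ω, ENNReal.ofReal (serviceDist x (fun j => Y j ω) ^ 2) ∂P =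
      ENNReal.ofReal (1 / (a * Real.pi)) := by
  have hpos : 0 < a * Real.pi := mul_pos ha Real.pi_pos
  -- Layer-cake formula: the tail of D² at t is exp(-aπt).
  rw [lintegral_eq_lintegral_meas_le P (.of_forall fun _ => sq_nonneg _)
    ((hY.measurable_serviceDist x).pow_const 2).aemeasurable]
  have h : ∀ t ∈ Ioi (0 : ℝ), P {ω | t ≤ serviceDist x (fun j => Y j ω) ^ 2} =
      ENNReal.ofReal (Real.exp (-(a * Real.pi) * t)) := by
    intro t ht
    simp_rw [← Real.sqrt_le_left (serviceDist_nonneg _ _)]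
    rw [hY.measure_le_serviceDist, ← ENNReal.ofReal_pow (Real.sqrt_nonneg t),
      Real.sq_sqrt (le_of_lt ht), ← ENNReal.ofReal_mul (le_of_lt ht), ← ENNReal.ofReal_mul ha.le,
      expNeg_ofReal (by have := mem_Ioi.1 ht; positivity)]
    congr 2
    ring
  rw [setLIntegral_congr_fun measurableSet_Ioi h,
    ← ofReal_integral_eq_lintegral_ofReal (integrableOn_exp_mul_Ioi (neg_lt_zero.2 hpos) 0)
      (.of_forall fun _ => (Real.exp_pos _).le), integral_exp_mul_Ioi (neg_lt_zero.2 hpos)]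
  congr 1
  rw [mul_zero, Real.exp_zero, neg_div_neg_eq]

/-! ### Radial integrals in the plane -/

/-- The substitution x ↦ dx has Jacobian d² in the plane. The condition G 0 = 0 handles d = 0, where
the substitution degenerates. -/
theorem lintegral_lt_norm_scaling (G : ℝ → ℝ≥0∞) (hG : Measurable G) (hG0 : G 0 = 0) {d : ℝ}
    (hd : 0 ≤ d) :
    ∫⁻ x : Plane, (if d < ‖x‖ then G (d / ‖x‖) else 0) =
      ENNReal.ofReal (d ^ 2) * ∫⁻ x : Plane, (if 1 < ‖x‖ then G (1 / ‖x‖) else 0) := by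
  rcases hd.eq_or_lt with rfl | hd
  · simp [hG0]
  have hF : Measurable fun x : Plane => if d < ‖x‖ then G (d / ‖x‖) else 0 :=
    Measurable.ite (measurableSet_lt measurable_const measurable_norm)
      (hG.comp (measurable_const.div measurable_norm)) measurable_const
  have h : ∀ x : Plane, (if 1 < ‖x‖ then G (1 / ‖x‖) else 0) =
      (if d < ‖d • x‖ then G (d / ‖d • x‖) else 0) := by
    intro x
    rw [norm_smul, Real.norm_of_nonneg hd.le]
    have h1 : d < d * ‖x‖ ↔ 1 < ‖x‖ := lt_mul_iff_one_lt_right hd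
    have h2 : d / (d * ‖x‖) = 1 / ‖x‖ := by
      rw [← div_div, div_self hd.ne']
    simp only [h1, h2]
  simp_rw [h]
  rw [← lintegral_map hF (measurable_const_smul d), Measure.map_addHaar_smul _ hd.ne',
    lintegral_smul_measure, smul_eq_mul, ← mul_assoc, ← ENNReal.ofReal_mul (by positivity),
    finrank_euclideanSpace_fin, abs_of_nonneg (by positivity), mul_inv_cancel₀ (by positivity),
    ENNReal.ofReal_one, one_mul]

/-- Polar coordinates; 2π arises as the dimension times the area π of the unit disc. -/
theorem lintegral_fun_norm_plane {f : ℝ → ℝ} (hf : ∀ u ∈ Ioi 1, 0 ≤ f u)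
    (hfi : IntegrableOn (fun u => u * f u) (Ioi 1)) :
    ∫⁻ x : Plane, (if 1 < ‖x‖ then ENNReal.ofReal (f ‖x‖) else 0) =
      ENNReal.ofReal (2 * Real.pi * ∫ u in Ioi 1, u * f u) := by
  let g : ℝ → ℝ := (Ioi 1).indicator f
  have hg : ∀ x : Plane, (if 1 < ‖x‖ then ENNReal.ofReal (f ‖x‖) else 0) =
      ENNReal.ofReal (g ‖x‖) := by
    intro x
    by_cases h : 1 < ‖x‖ <;> simp [g, h]
  have hgmul : ∀ u, u ^ (Module.finrank ℝ Plane - 1) • g u =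
      (Ioi 1).indicator (fun u => u * f u) u := by
    intro u
    rw [finrank_euclideanSpace_fin]
    by_cases h : 1 < u <;> simp [g, h]
  have hsub : Ioi (1 : ℝ) ⊆ Ioi 0 := Ioi_subset_Ioi zero_le_one
  have hint : Integrable fun x : Plane => g ‖x‖ := by
    rw [integrable_fun_norm_addHaar]
    simp_rw [hgmul]
    rw [integrableOn_indicator_iff measurableSet_Ioi, inter_eq_left.2 hsub]
    exact hfi
  simp_rw [hg]
  rw [← ofReal_integral_eq_lintegral_ofReal hint
    (.of_forall fun x => indicator_nonneg hf _), integral_fun_norm_addHaar]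
  simp_rw [hgmul]
  rw [setIntegral_indicator measurableSet_Ioi, inter_eq_right.2 hsub, finrank_euclideanSpace_fin,
    measureReal_def, EuclideanSpace.volume_ball_fin_two]
  simp [ENNReal.toReal_ofReal Real.pi_pos.le, mul_assoc]

/-! ### Integral representation of the hypergeometric function -/

theorem one_sub_mul_ne_zero_of_mem_cutPlane {z : ℂ} (hz : z ∈ cutPlane) {v : ℝ}
    (hv : v ∈ Icc (0 : ℝ) 1) : 1 - z * v ≠ 0 := by
  intro h
  have hv0 : v ≠ 0 := by
    rintro rfl
    simp at h
  have hvpos : 0 < v := lt_of_le_of_ne hv.1 hv0.symm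
  have hzv : z = ((v⁻¹ : ℝ) : ℂ) := by
    rw [Complex.ofReal_inv]
    exact eq_inv_of_mul_eq_one_left (sub_eq_zero.1 h).symm
  have h1 : 1 - z = ((1 - v⁻¹ : ℝ) : ℂ) := by rw [hzv]; push_cast; ring
  have h2 : 1 - z ∈ Complex.slitPlane := hz
  rw [h1, Complex.ofReal_mem_slitPlane] at h2
  have := (one_le_inv₀ hvpos).2 hv.2
  linarith

/-- A continuous nonvanishing function on a compact set is bounded away from zero. The uniform ε
provides the domination for differentiating under the integral. -/
theorem exists_norm_one_sub_mul_ge {z₀ : ℂ} (hz₀ : z₀ ∈ cutPlane) :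
    ∃ r > 0, ∃ ε > 0, Metric.closedBall z₀ r ⊆ cutPlane ∧
      ∀ z ∈ Metric.closedBall z₀ r, ∀ v ∈ Icc (0 : ℝ) 1, ε ≤ ‖1 - z * v‖ := by
  obtain ⟨r, hr, hball⟩ := Metric.nhds_basis_closedBall.mem_iff.1 (isOpen_cutPlane.mem_nhds hz₀)
  have hK : IsCompact (Metric.closedBall z₀ r ×ˢ Icc (0 : ℝ) 1) :=
    (isCompact_closedBall z₀ r).prod isCompact_Icc
  have hne : (Metric.closedBall z₀ r ×ˢ Icc (0 : ℝ) 1).Nonempty :=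
    ⟨(z₀, 0), Metric.mem_closedBall_self hr.le, by simp⟩
  obtain ⟨p, hp, hmin⟩ := hK.exists_isMinOn hne
    (f := fun p : ℂ × ℝ => ‖1 - p.1 * p.2‖) (by fun_prop)
  refine ⟨r, hr, ‖1 - p.1 * p.2‖,
    norm_pos_iff.2 (one_sub_mul_ne_zero_of_mem_cutPlane (hball hp.1) hp.2), hball, ?_⟩
  intro z hz v hv
  exact hmin (show (z, v) ∈ _ from ⟨hz, hv⟩)

theorem rpow_neg_mem_Icc {η : ℝ} (hη : 2 < η) {u : ℝ} (hu : u ∈ Ioi (1 : ℝ)) :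
    u ^ (-η) ∈ Icc (0 : ℝ) 1 :=
  ⟨Real.rpow_nonneg (zero_le_one.trans (le_of_lt hu)) _,
    Real.rpow_le_one_of_one_le_of_nonpos (le_of_lt hu) (by linarith)⟩

theorem integrableOn_rpow_one_sub {η : ℝ} (hη : 2 < η) :
    IntegrableOn (fun u : ℝ => u ^ (1 - η)) (Ioi 1) :=
  integrableOn_Ioi_rpow_of_lt (by linarith) one_pos

theorem differentiableOn_integral_rpow_div {η : ℝ} (hη : 2 < η) :
    DifferentiableOn ℂ (fun z : ℂ => ∫ u in Ioi (1 : ℝ),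
      ((u ^ (1 - η) : ℝ) : ℂ) / (1 - z * ((u ^ (-η) : ℝ) : ℂ))) cutPlane := by
  intro z₀ hz₀
  obtain ⟨r, hr, ε, hε, -, hbd⟩ := exists_norm_one_sub_mul_ge hz₀
  have hmeas : ∀ z : ℂ, Measurable fun u : ℝ =>
      ((u ^ (1 - η) : ℝ) : ℂ) / (1 - z * ((u ^ (-η) : ℝ) : ℂ)) := fun z => by fun_prop
  have h := hasDerivAt_integral_of_dominated_loc_of_deriv_le (μ := volume.restrict (Ioi (1 : ℝ)))
    (F := fun (z : ℂ) (u : ℝ) => ((u ^ (1 - η) : ℝ) : ℂ) / (1 - z * ((u ^ (-η) : ℝ) : ℂ)))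
    (F' := fun (z : ℂ) (u : ℝ) => ((u ^ (1 - η) : ℝ) : ℂ) * ((u ^ (-η) : ℝ) : ℂ) /
      (1 - z * ((u ^ (-η) : ℝ) : ℂ)) ^ 2)
    -- The extra factor u^(-η) in the derivative is at most 1, and the denominator is at least ε² in
    -- norm.
    (bound := fun u => u ^ (1 - η) / ε ^ 2)
    (Metric.closedBall_mem_nhds z₀ hr) (.of_forall fun z => (hmeas z).aestronglyMeasurable)
    ?_ (Measurable.aestronglyMeasurable (by fun_prop)) ?_
    ((integrableOn_rpow_one_sub hη).div_const _) ?_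
  · exact h.2.differentiableAt.differentiableWithinAt
  · refine Integrable.mono' ((integrableOn_rpow_one_sub hη).div_const ε)
      (hmeas z₀).aestronglyMeasurable ?_
    filter_upwards [ae_restrict_mem measurableSet_Ioi] with u hu
    have hu0 : 0 ≤ u := zero_le_one.trans (le_of_lt hu)
    rw [norm_div, Complex.norm_of_nonneg (Real.rpow_nonneg hu0 _)]
    exact div_le_div_of_nonneg_left (Real.rpow_nonneg hu0 _) hε
      (hbd z₀ (Metric.mem_closedBall_self hr.le) _ (rpow_neg_mem_Icc hη hu))
  · filter_upwards [ae_restrict_mem measurableSet_Ioi] with u hu z hz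
    have hu0 : 0 ≤ u := zero_le_one.trans (le_of_lt hu)
    have hv := rpow_neg_mem_Icc hη hu
    rw [norm_div, norm_mul, norm_pow, Complex.norm_of_nonneg (Real.rpow_nonneg hu0 _),
      Complex.norm_of_nonneg hv.1]
    exact div_le_div₀ (Real.rpow_nonneg hu0 _)
      (mul_le_of_le_one_right (Real.rpow_nonneg hu0 _) hv.2) (by positivity)
      (pow_le_pow_left₀ hε.le (hbd z hz _ hv) 2)
  · filter_upwards [ae_restrict_mem measurableSet_Ioi] with u hu z hz
    have hne : 1 - z * ((u ^ (-η) : ℝ) : ℂ) ≠ 0 :=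
      norm_pos_iff.1 (hε.trans_le (hbd z hz _ (rpow_neg_mem_Icc hη hu)))
    have hd : HasDerivAt (fun z : ℂ => 1 - z * ((u ^ (-η) : ℝ) : ℂ)) (-((u ^ (-η) : ℝ) : ℂ)) z := by
      simpa using ((hasDerivAt_id z).mul_const ((u ^ (-η) : ℝ) : ℂ)).const_sub 1
    refine ((hasDerivAt_const z ((u ^ (1 - η) : ℝ) : ℂ)).div hd hne).congr_deriv ?_
    ring

/-- The products (b)_n and (b+1)_n share all factors except b and b + n. -/
theorem ascPochhammer_eval_div_eval_add_one (b : ℂ) (hb : ∀ n : ℕ, b + n ≠ 0) (n : ℕ) :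
    (ascPochhammer ℂ n).eval b * ((ascPochhammer ℂ n).eval (b + 1))⁻¹ = b / (b + n) := by
  have hne : ∀ m : ℕ, (ascPochhammer ℂ m).eval (b + 1) ≠ 0 := by
    intro m
    induction m with
    | zero => simp
    | succ m ih =>
      rw [ascPochhammer_succ_eval]
      refine mul_ne_zero ih ?_
      have := hb (m + 1)
      push_cast at this
      rwa [add_assoc, add_comm (1 : ℂ)]
  induction n with
  | zero =>
    have := hb 0
    simp only [Nat.cast_zero, add_zero] at this ⊢
    simp [this]
  | succ n ih =>
    have h1 := hb n
    have h2 := hb (n + 1)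
    have h3 := hne n
    push_cast at h2 ⊢
    have h4 : b + 1 + (n : ℂ) ≠ 0 := by rwa [add_assoc, add_comm (1 : ℂ)]
    rw [ascPochhammer_succ_eval, ascPochhammer_succ_eval]
    rw [← div_eq_mul_inv, div_eq_div_iff h3 h1] at ih
    field_simp
    linear_combination (b + n + 1) * ih

/-- The integrand is expanded as a geometric series in z u^(-η). Exchanging sum and integral is
justified by comparing the integrated norms with ‖z‖^n/(η-2). -/
theorem hasSum_integral_rpow_div {η : ℝ} (hη : 2 < η) {z : ℂ} (hz : ‖z‖ < 1) :
    HasSum (fun n : ℕ => z ^ n / (η * n + η - 2 : ℂ))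
      (∫ u in Ioi (1 : ℝ), ((u ^ (1 - η) : ℝ) : ℂ) / (1 - z * ((u ^ (-η) : ℝ) : ℂ))) := by
  have hexp : ∀ n : ℕ, 1 - η - η * n < -1 := fun n => by
    have : 0 ≤ η * n := by positivity
    linarith
  have hden : ∀ n : ℕ, 0 < η * n + η - 2 := fun n => by linarith [hexp n]
  let F : ℕ → ℝ → ℂ := fun n u => z ^ n * ((u ^ (1 - η - η * n) : ℝ) : ℂ)
  have hint : ∀ n, IntegrableOn (F n) (Ioi 1) := fun n =>
    (integrableOn_Ioi_rpow_of_lt (hexp n) one_pos).ofReal.const_mul _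
  have hval : ∀ n : ℕ, ∫ u in Ioi (1 : ℝ), u ^ (1 - η - η * n) = 1 / (η * n + η - 2) := by
    intro n
    rw [integral_Ioi_rpow_of_lt (hexp n) one_pos, Real.one_rpow, neg_div,
      ← div_neg]
    congr 1
    ring
  have hnorm : ∀ n, ∫ u in Ioi (1 : ℝ), ‖F n u‖ = ‖z‖ ^ n * (1 / (η * n + η - 2)) := by
    intro n
    rw [← hval n, ← integral_const_mul]
    refine setIntegral_congr_fun measurableSet_Ioi fun u hu => ?_
    have hu0 : 0 ≤ u := zero_le_one.trans (le_of_lt hu)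
    simp only [F]
    rw [norm_mul, norm_pow, Complex.norm_of_nonneg (Real.rpow_nonneg hu0 _)]
  have hsum : Summable fun n => ∫ u in Ioi (1 : ℝ), ‖F n u‖ := by
    simp_rw [hnorm]
    refine Summable.of_nonneg_of_le (fun n => ?_) (fun n => ?_)
      ((summable_geometric_of_lt_one (norm_nonneg z) hz).mul_right (1 / (η - 2)))
    · have := hden n
      positivity
    · refine mul_le_mul_of_nonneg_left ?_ (by positivity)
      refine one_div_le_one_div_of_le (by linarith) ?_
      have : 0 ≤ η * n := by positivity
      linarith
  have h := hasSum_integral_of_summable_integral_norm hint hsum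
  convert! h using 1
  · funext n
    simp only [F]
    rw [integral_const_mul, integral_complex_ofReal, hval n]
    push_cast
    rw [mul_one_div]
  · refine setIntegral_congr_fun measurableSet_Ioi fun u hu => ?_
    have hu0 : 0 < u := zero_lt_one.trans hu
    have hv := rpow_neg_mem_Icc hη hu
    have hlt : ‖z * ((u ^ (-η) : ℝ) : ℂ)‖ < 1 := by
      rw [norm_mul, Complex.norm_of_nonneg hv.1]
      exact (mul_le_of_le_one_right (norm_nonneg _) hv.2).trans_lt hz
    rw [div_eq_mul_inv, ← tsum_geometric_of_norm_lt_one hlt, ← tsum_mul_left]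
    refine tsum_congr fun n => ?_
    have : u ^ (1 - η - η * n) = u ^ (1 - η) * (u ^ (-η)) ^ n := by
      rw [← Real.rpow_natCast, ← Real.rpow_mul hu0.le, ← Real.rpow_add hu0]
      congr 1
      ring
    simp only [F]
    rw [this, mul_pow]
    push_cast
    ring

/-- With a = 1 the factor (1)_n cancels n!. With b = 1 - 2/η and c = b + 1 the remaining coefficient
is b/(b+n) = (η-2)/(ηn+η-2). -/
theorem isHypergeometricContinuation_integral {η : ℝ} (hη : 2 < η) :
    IsHypergeometricContinuation 1 (1 - 2 / (η : ℂ)) (2 - 2 / (η : ℂ))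
      (fun z => ((η - 2 : ℝ) : ℂ) * ∫ u in Ioi (1 : ℝ),
        ((u ^ (1 - η) : ℝ) : ℂ) / (1 - z * ((u ^ (-η) : ℝ) : ℂ))) := by
  refine ⟨(differentiableOn_integral_rpow_div hη).const_mul _, fun z hz => ?_⟩
  have hz' : ‖z‖ < 1 := by simpa using hz
  have h := (hasSum_integral_rpow_div hη hz').mul_left ((η - 2 : ℝ) : ℂ)
  change _ * _ = _
  rw [← h.tsum_eq, ordinaryHypergeometric_eq_tsum]
  refine tsum_congr fun n => ?_
  have hη0 : (η : ℂ) ≠ 0 := by exact_mod_cast (by linarith : η ≠ 0)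
  have hden : ∀ m : ℕ, (η * m + η - 2 : ℂ) ≠ 0 := fun m => by
    have h1 : 0 ≤ η * m := by positivity
    have h2 : η * m + η - 2 ≠ 0 := by linarith
    exact_mod_cast h2
  have hbm : ∀ m : ℕ, 1 - 2 / (η : ℂ) + m = (η * m + η - 2) / η := fun m => by
    field_simp
    ring
  have hb : ∀ m : ℕ, 1 - 2 / (η : ℂ) + m ≠ 0 := fun m => by
    rw [hbm]
    exact div_ne_zero (hden m) hη0
  have hp := ascPochhammer_eval_div_eval_add_one _ hb n
  have hc : 1 - 2 / (η : ℂ) + 1 = 2 - 2 / (η : ℂ) := by ring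
  rw [hc, hbm n] at hp
  have hfac : ((n.factorial : ℂ)) ≠ 0 := by exact_mod_cast n.factorial_ne_zero
  have h1 : (ascPochhammer ℂ n).eval (1 : ℂ) = n.factorial := ascPochhammer_eval_one ℂ n
  have := hden n
  rw [smul_eq_mul, h1, inv_mul_cancel₀ hfac, one_mul, hp]
  push_cast
  field_simp

theorem gaussHypergeometric_neg_eq_integral {η θ : ℝ} (hη : 2 < η) (hθ : 0 < θ) :
    gaussHypergeometric 1 (1 - 2 / (η : ℂ)) (2 - 2 / (η : ℂ)) (-(θ : ℂ)) =
      (((η - 2) * ∫ u in Ioi (1 : ℝ), u ^ (1 - η) / (1 + θ * u ^ (-η)) : ℝ) : ℂ) := by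
  have hz : -(θ : ℂ) ∈ cutPlane := by
    have : 1 - -(θ : ℂ) = ((1 + θ : ℝ) : ℂ) := by push_cast; ring
    change 1 - -(θ : ℂ) ∈ Complex.slitPlane
    rw [this, Complex.ofReal_mem_slitPlane]
    linarith
  rw [gaussHypergeometric_eq (isHypergeometricContinuation_integral hη) hz, Complex.ofReal_mul]
  congr 1
  refine Eq.trans ?_ integral_complex_ofReal
  refine integral_congr_ae (.of_forall fun u => ?_)
  push_cast
  ring_nf

theorem integral_rpow_div_of_eq_four {θ : ℝ} (hθ : 0 < θ) :
    θ * ∫ u in Ioi (1 : ℝ), u ^ (1 - (4 : ℝ)) / (1 + θ * u ^ (-(4 : ℝ))) =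
      √θ / 2 * Real.arctan √θ := by
  -- The primitive is (√θ/2) arctan(u²/√θ). Nonnegativity of its derivative gives integrability, and
  -- the reflection arctan(1/s) = π/2 - arctan s simplifies the difference of boundary values.
  have hs : 0 < √θ := Real.sqrt_pos.2 hθ
  have hs2 : √θ ^ 2 = θ := Real.sq_sqrt hθ.le
  have hd : ∀ u ∈ Ioi (1 : ℝ), HasDerivAt (fun u => √θ / 2 * Real.arctan (u ^ 2 / √θ))
      (θ * (u ^ (1 - (4 : ℝ)) / (1 + θ * u ^ (-(4 : ℝ))))) u := by
    intro u hu
    have hu0 : 0 < u := zero_lt_one.trans hu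
    have h := (((hasDerivAt_pow 2 u).div_const √θ).arctan).const_mul (√θ / 2)
    refine h.congr_deriv ?_
    have h1 : u ^ (1 - (4 : ℝ)) = (u ^ 3)⁻¹ := by
      rw [← Real.rpow_natCast, ← Real.rpow_neg hu0.le]
      norm_num
    have h2 : u ^ (-(4 : ℝ)) = (u ^ 4)⁻¹ := by
      rw [← Real.rpow_natCast, ← Real.rpow_neg hu0.le]
      norm_num
    rw [h1, h2, div_pow, hs2]
    have h3 : u ^ 4 + θ ≠ 0 := by positivity
    have h4 : θ + u ^ 4 ≠ 0 := by positivity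
    field_simp
    push_cast
    ring
  have hlim : Filter.Tendsto (fun u => √θ / 2 * Real.arctan (u ^ 2 / √θ)) Filter.atTop
      (nhds (√θ / 2 * (Real.pi / 2))) := by
    refine Filter.Tendsto.const_mul _ ?_
    refine (tendsto_nhds_of_tendsto_nhdsWithin Real.tendsto_arctan_atTop).comp ?_
    exact (Filter.tendsto_pow_atTop two_ne_zero).atTop_div_const hs
  rw [← integral_const_mul, integral_Ioi_of_hasDerivAt_of_nonneg
    (Continuous.continuousWithinAt (by fun_prop)) hd ?_ hlim]
  · rw [one_pow, one_div, Real.arctan_inv_of_pos hs]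
    ring
  · intro u hu
    have hu0 : 0 < u := zero_lt_one.trans hu
    positivity

/-! ### The interference -/

/-- Ratio of the mean interference from a device at `x` with service distance `d` to the mean
useful power, multiplied by the SINR threshold `θ`. -/
def interferenceCoeff (η θ : ℝ) (x : Plane) (d : ℝ) : ℝ :=
  if d < ‖x‖ then θ * (d / ‖x‖) ^ η else 0

theorem measurable_interferenceCoeff (η θ : ℝ) :
    Measurable fun p : Plane × ℝ => interferenceCoeff η θ p.1 p.2 :=
  Measurable.ite (measurableSet_lt measurable_snd measurable_fst.norm)
    (by fun_prop) measurable_const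

theorem interferenceCoeff_nonneg {η θ : ℝ} (hθ : 0 < θ) (x : Plane) {d : ℝ} (hd : 0 ≤ d) :
    0 ≤ interferenceCoeff η θ x d := by
  unfold interferenceCoeff
  split_ifs <;> positivity

theorem lintegral_plane_rpow_div {η θ : ℝ} (hη : 2 < η) (hθ : 0 < θ) :
    ∫⁻ x : Plane, (if 1 < ‖x‖ then
      ENNReal.ofReal (θ * (1 / ‖x‖) ^ η / (1 + θ * (1 / ‖x‖) ^ η)) else 0) =
      ENNReal.ofReal (2 * Real.pi * (θ * ∫ u in Ioi (1 : ℝ),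
        u ^ (1 - η) / (1 + θ * u ^ (-η)))) := by
  have heq : ∀ u ∈ Ioi (1 : ℝ), u * (θ * (1 / u) ^ η / (1 + θ * (1 / u) ^ η)) =
      θ * (u ^ (1 - η) / (1 + θ * u ^ (-η))) := by
    intro u hu
    have hu0 : 0 < u := zero_lt_one.trans hu
    rw [one_div, Real.inv_rpow hu0.le, ← Real.rpow_neg hu0.le, sub_eq_add_neg,
      Real.rpow_add hu0, Real.rpow_one]
    ring
  have hint : IntegrableOn (fun u : ℝ => θ * (u ^ (1 - η) / (1 + θ * u ^ (-η)))) (Ioi 1) := by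
    refine Integrable.const_mul (Integrable.mono' (integrableOn_rpow_one_sub hη)
      (Measurable.aestronglyMeasurable (by fun_prop)) ?_) θ
    filter_upwards [ae_restrict_mem measurableSet_Ioi] with u hu
    have hu0 : 0 < u := zero_lt_one.trans hu
    rw [Real.norm_of_nonneg (by positivity)]
    refine div_le_self (by positivity) ?_
    have : 0 ≤ θ * u ^ (-η) := by positivity
    linarith
  rw [lintegral_fun_norm_plane (f := fun u => θ * (1 / u) ^ η / (1 + θ * (1 / u) ^ η))
    (fun u hu => ?_) (hint.congr_fun (fun u hu => (heq u hu).symm) measurableSet_Ioi),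
    setIntegral_congr_fun measurableSet_Ioi heq, integral_const_mul]
  have hu0 : 0 < u := zero_lt_one.trans hu
  positivity

/-- The two integrands add up to 1; finiteness permits the subtraction in `[0, ∞]`. -/
theorem one_sub_lintegral_one_div {α : Type*} [MeasurableSpace α] (ν : Measure α)
    [IsProbabilityMeasure ν] {c : α → ℝ} (hc : Measurable c) (hc0 : ∀ᵐ d ∂ν, 0 ≤ c d) :
    1 - ∫⁻ d, ENNReal.ofReal (1 / (1 + c d)) ∂ν = ∫⁻ d, ENNReal.ofReal (c d / (1 + c d)) ∂ν := by
  have hsum : ∫⁻ d, ENNReal.ofReal (1 / (1 + c d)) ∂ν + ∫⁻ d, ENNReal.ofReal (c d / (1 + c d)) ∂ν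
      = 1 := by
    rw [← lintegral_add_left (by fun_prop)]
    calc _ = ∫⁻ _, 1 ∂ν := by
          refine lintegral_congr_ae ?_
          filter_upwards [hc0] with d hd
          rw [← ENNReal.ofReal_add (by positivity) (by positivity), ← add_div,
            div_self (by positivity), ENNReal.ofReal_one]
      _ = 1 := by simp
  have hfin : ∫⁻ d, ENNReal.ofReal (1 / (1 + c d)) ∂ν ≠ ∞ :=
    ne_top_of_le_ne_top ENNReal.one_ne_top (hsum ▸ le_self_add)
  rw [← hsum, ENNReal.add_sub_cancel_left hfin]

/-- After Tonelli the inner plane integral depends on d only through the factor d² produced by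
scaling, so ν enters through its second moment alone. -/
theorem lintegral_one_sub_lintegral_interferenceCoeff {η θ : ℝ} (hη : 2 < η) (hθ : 0 < θ)
    (ν : Measure ℝ) [IsProbabilityMeasure ν] (hν : ∀ᵐ d ∂ν, 0 ≤ d) :
    ∫⁻ x, 1 - ∫⁻ d, ENNReal.ofReal (1 / (1 + interferenceCoeff η θ x d)) ∂ν =
      (∫⁻ d, ENNReal.ofReal (d ^ 2) ∂ν) * ENNReal.ofReal (2 * Real.pi *
        (θ * ∫ u in Ioi (1 : ℝ), u ^ (1 - η) / (1 + θ * u ^ (-η)))) := by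
  have hm := measurable_interferenceCoeff η θ
  have h1 : ∀ x, 1 - ∫⁻ d, ENNReal.ofReal (1 / (1 + interferenceCoeff η θ x d)) ∂ν =
      ∫⁻ d, ENNReal.ofReal (interferenceCoeff η θ x d / (1 + interferenceCoeff η θ x d)) ∂ν :=
    fun x => one_sub_lintegral_one_div ν (hm.comp measurable_prodMk_left)
      (hν.mono fun d hd => interferenceCoeff_nonneg hθ x hd)
  let G : ℝ → ℝ≥0∞ := fun t => ENNReal.ofReal (θ * t ^ η / (1 + θ * t ^ η))
  have hG : Measurable G := by fun_prop
  have hG0 : G 0 = 0 := by simp [G, Real.zero_rpow (by linarith : η ≠ 0)]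
  have h2 : ∀ d (x : Plane),
      ENNReal.ofReal (interferenceCoeff η θ x d / (1 + interferenceCoeff η θ x d)) =
        if d < ‖x‖ then G (d / ‖x‖) else 0 := by
    intro d x
    unfold interferenceCoeff
    split_ifs <;> simp [G]
  simp_rw [h1]
  rw [lintegral_lintegral_swap (Measurable.aemeasurable
    (hm.div (measurable_const.add hm)).ennreal_ofReal), ← lintegral_plane_rpow_div hη hθ,
    ← lintegral_mul_const _ (by fun_prop)]
  refine lintegral_congr_ae ?_
  filter_upwards [hν] with d hd
  simp_rw [h2]
  exact lintegral_lt_norm_scaling G hG hG0 hd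

/-- The target power cancels: path-loss inversion makes the received interference power ρ(d/|x|)^η
times the gain. -/
theorem mul_interference_eq {ρ η θ : ℝ} (hρ : 0 < ρ) (hθ : 0 < θ) (x : ℕ → Plane)
    (y : ℕ → ℕ → Plane) (g : ℕ → ℝ) :
    ENNReal.ofReal (θ / ρ) * interference ρ η x y g =
      ∑' i, ENNReal.ofReal (interferenceCoeff η θ (x i) (serviceDist (x i) (y i)) * g i) := by
  rw [interference, ← ENNReal.tsum_mul_left]
  refine tsum_congr fun i => ?_
  unfold interferenceCoeff
  split_ifs with h
  · rw [← ENNReal.ofReal_mul (by positivity), transmitPower,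
      Real.div_rpow (serviceDist_nonneg _ _) (norm_nonneg _), Real.rpow_neg (norm_nonneg _)]
    congr 1
    field_simp
  · simp

theorem measurable_interference (ρ η : ℝ) :
    Measurable fun p : (ℕ → Plane) × (ℕ → ℕ → Plane) × (ℕ → ℝ) =>
      interference ρ η p.1 p.2.1 p.2.2 := by
  refine Measurable.tsum fun i => ?_
  have hx : Measurable fun p : (ℕ → Plane) × (ℕ → ℕ → Plane) × (ℕ → ℝ) => p.1 i := by fun_prop
  have hy : Measurable fun p : (ℕ → Plane) × (ℕ → ℕ → Plane) × (ℕ → ℝ) => p.2.1 i := by fun_prop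
  have hg : Measurable fun p : (ℕ → Plane) × (ℕ → ℕ → Plane) × (ℕ → ℝ) => p.2.2 i := by fun_prop
  have hd := measurable_serviceDist.comp (hx.prodMk hy)
  exact Measurable.ite (measurableSet_lt hd hx.norm)
    ((((hd.pow_const η).const_mul ρ).mul hg).mul (hx.norm.pow_const (-η))).ennreal_ofReal
    measurable_const

theorem ofReal_lt_sinr_iff {ρ η N θ : ℝ} (hρ : 0 < ρ) (hθ : 0 < θ) (x : ℕ → Plane)
    (y : ℕ → ℕ → Plane) (g : ℕ → ℝ) (g₀ : ℝ) :
    ENNReal.ofReal θ < sinr ρ η N x y g g₀ ↔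
      ENNReal.ofReal (θ / ρ) * (ENNReal.ofReal N + interference ρ η x y g) <
        ENNReal.ofReal g₀ := by
  have hρ0 : ENNReal.ofReal ρ ≠ 0 := by simpa using hρ
  rw [sinr, ENNReal.lt_div_iff_mul_lt (Or.inr ENNReal.ofReal_ne_top)
    (Or.inr (by simpa using hθ)), ENNReal.ofReal_div_of_pos hρ, ENNReal.ofReal_mul hρ.le,
    ENNReal.div_eq_inv_mul, mul_assoc, ← ENNReal.div_eq_inv_mul,
    ENNReal.div_lt_iff (Or.inl hρ0) (Or.inl ENNReal.ofReal_ne_top), mul_comm (ENNReal.ofReal g₀)]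

/-! ### Successive averaging over the gains, the heads and the members -/

namespace IsD2DNetwork

variable {Ω : Type*} [MeasurableSpace Ω] {P : Measure Ω}
  {μ δ : ℝ} {k : ℕ} {X : ℕ → Ω → Plane} {Y : ℕ → ℕ → Ω → Plane} {h : ℕ → Ω → ℝ} {h₀ : Ω → ℝ}

theorem measurable_members (hnet : IsD2DNetwork P μ δ k X Y h h₀) :
    Measurable fun ω i => X i ω :=
  measurable_pi_lambda _ fun i => IsPoissonPointProcess.measurable hnet.members i

theorem measurable_heads (hnet : IsD2DNetwork P μ δ k X Y h h₀) :
    Measurable fun ω i j => Y i j ω :=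
  measurable_pi_lambda _ fun i => measurable_pi_lambda _ fun j =>
    IsPoissonPointProcess.measurable (hnet.heads i) j

theorem measurable_gains (hnet : IsD2DNetwork P μ δ k X Y h h₀) : Measurable fun ω i => h i ω :=
  measurable_pi_lambda _ hnet.measurable_gain

/-- The Laplace transform of the interference, given the positions of all the devices. -/
theorem lintegral_expNeg_gains (hnet : IsD2DNetwork P μ δ k X Y h h₀) {c : ℕ → ℝ}
    (hc : ∀ i, 0 ≤ c i) :
    ∫⁻ ω, expNeg (∑' i, ENNReal.ofReal (c i * h i ω)) ∂P =
      expNeg (∑' i, negLog (ENNReal.ofReal (1 / (1 + c i)))) := by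
  rw [lintegral_expNeg_tsum (fun i => ((hnet.measurable_gain i).const_mul (c i)).ennreal_ofReal)
    (hnet.indep_gain.comp (fun i g => ENNReal.ofReal (c i * g)) fun i => by fun_prop)]
  congr 1
  refine tsum_congr fun i => ?_
  rw [← lintegral_expNeg_mul_expMeasure (hc i), ← hnet.gain i,
    lintegral_map (f := fun g => expNeg (ENNReal.ofReal (c i * g)))
      (measurable_expNeg.comp (by fun_prop)) (hnet.measurable_gain i)]

variable [IsProbabilityMeasure P]

/-- The success probability is the Laplace transform of noise plus interference at `θ / ρ`. -/
theorem measure_lt_sinr (hnet : IsD2DNetwork P μ δ k X Y h h₀) {ρ η N θ : ℝ} (hρ : 0 < ρ)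
    (hθ : 0 < θ) :
    P {ω | ENNReal.ofReal θ <
      sinr ρ η N (fun i => X i ω) (fun i j => Y i j ω) (fun i => h i ω) (h₀ ω)} =
    ∫⁻ ω, expNeg (ENNReal.ofReal (θ / ρ) * (ENNReal.ofReal N +
      interference ρ η (fun i => X i ω) (fun i j => Y i j ω) (fun i => h i ω))) ∂P := by
  let S : (ℕ → Plane) × (ℕ → ℕ → Plane) × (ℕ → ℝ) → ℝ≥0∞ := fun p =>
    ENNReal.ofReal (θ / ρ) * (ENNReal.ofReal N + interference ρ η p.1 p.2.1 p.2.2)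
  let A : Ω → (ℕ → Plane) × (ℕ → ℕ → Plane) × (ℕ → ℝ) := fun ω =>
    (fun i => X i ω, fun i j => Y i j ω, fun i => h i ω)
  have hS : Measurable S := ((measurable_interference ρ η).const_add _).const_mul _
  have hA : Measurable A :=
    hnet.measurable_members.prodMk (hnet.measurable_heads.prodMk hnet.measurable_gains)
  have hE : MeasurableSet {q : ((ℕ → Plane) × (ℕ → ℕ → Plane) × (ℕ → ℝ)) × ℝ |
      S q.1 < ENNReal.ofReal q.2} :=
    measurableSet_lt (hS.comp measurable_fst) measurable_snd.ennreal_ofReal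
  simp_rw [ofReal_lt_sinr_iff hρ hθ]
  change P {ω | S (A ω) < ENNReal.ofReal (h₀ ω)} = ∫⁻ ω, expNeg (S (A ω)) ∂P
  -- Positions and interfering gains are frozen; the remaining probability over the test gain is an
  -- exponential tail.
  have key := hnet.indep_testGain.symm.lintegral_eq_lintegral_lintegral hA hnet.measurable_testGain
    (F := fun p g => {q : ((ℕ → Plane) × (ℕ → ℕ → Plane) × (ℕ → ℝ)) × ℝ |
      S q.1 < ENNReal.ofReal q.2}.indicator 1 (p, g)) (measurable_one.indicator hE)
  have hP : P {ω | S (A ω) < ENNReal.ofReal (h₀ ω)} = ∫⁻ ω,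
      {q : ((ℕ → Plane) × (ℕ → ℕ → Plane) × (ℕ → ℝ)) × ℝ |
        S q.1 < ENNReal.ofReal q.2}.indicator 1 (A ω, h₀ ω) ∂P := by
    exact (lintegral_indicator_one (hE.preimage (hA.prodMk hnet.measurable_testGain))).symm
  rw [hP, key]
  refine lintegral_congr fun ω => ?_
  have hs : MeasurableSet {g : ℝ | S (A ω) < ENNReal.ofReal g} :=
    measurableSet_lt measurable_const ENNReal.measurable_ofReal
  rw [← expMeasure_lt_ofReal, ← hnet.testGain, Measure.map_apply hnet.measurable_testGain hs,
    ← lintegral_indicator_one (hnet.measurable_testGain hs)]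
  rfl

/-- The Laplace transform of the interference, given the positions of the cluster members. -/
theorem lintegral_expNeg_heads_gains (hnet : IsD2DNetwork P μ δ k X Y h h₀) {η θ : ℝ}
    (hθ : 0 < θ) (x : ℕ → Plane) :
    ∫⁻ ω, expNeg (∑' i, ENNReal.ofReal
        (interferenceCoeff η θ (x i) (serviceDist (x i) fun j => Y i j ω) * h i ω)) ∂P =
      expNeg (∑' i, negLog (∫⁻ d, ENNReal.ofReal (1 / (1 + interferenceCoeff η θ (x i) d))
        ∂(P.map fun ω => serviceDist 0 fun j => Y 0 j ω))) := by
  have hcm : ∀ i, Measurable fun y : ℕ → Plane =>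
      interferenceCoeff η θ (x i) (serviceDist (x i) y) := fun i =>
    (measurable_interferenceCoeff η θ).comp (measurable_const.prodMk
      (measurable_serviceDist.comp (measurable_const.prodMk measurable_id)))
  have hF : Measurable (Function.uncurry fun (y : ℕ → ℕ → Plane) (g : ℕ → ℝ) =>
      expNeg (∑' i, ENNReal.ofReal
        (interferenceCoeff η θ (x i) (serviceDist (x i) (y i)) * g i))) :=
    measurable_expNeg.comp <| Measurable.tsum fun i =>
      (((hcm i).comp ((measurable_pi_apply i).comp measurable_fst)).mul
        ((measurable_pi_apply i).comp measurable_snd)).ennreal_ofReal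
  refine (hnet.indep_heads_gain.lintegral_eq_lintegral_lintegral hnet.measurable_heads
    hnet.measurable_gains hF).trans ?_
  have hcond : ∀ ω, ∫⁻ ω', expNeg (∑' i, ENNReal.ofReal
      (interferenceCoeff η θ (x i) (serviceDist (x i) fun j => Y i j ω) * h i ω')) ∂P =
      expNeg (∑' i, negLog (ENNReal.ofReal
        (1 / (1 + interferenceCoeff η θ (x i) (serviceDist (x i) fun j => Y i j ω))))) := fun ω =>
    hnet.lintegral_expNeg_gains fun i => interferenceCoeff_nonneg hθ _ (serviceDist_nonneg _ _)
  simp_rw [hcond]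
  have hZ : ∀ i, Measurable fun y : ℕ → Plane => negLog (ENNReal.ofReal
      (1 / (1 + interferenceCoeff η θ (x i) (serviceDist (x i) y)))) := fun i =>
    measurable_negLog.comp (measurable_const.div (measurable_const.add (hcm i))).ennreal_ofReal
  have hY : ∀ i, Measurable fun ω j => Y i j ω := fun i =>
    (measurable_pi_apply i).comp hnet.measurable_heads
  refine (lintegral_expNeg_tsum (fun i => (hZ i).comp (hY i))
    (hnet.indep_heads.comp _ hZ)).trans ?_
  congr 1
  refine tsum_congr fun i => ?_
  congr 1
  -- All members share one service-distance law; head process 0 seen from the origin is an arbitrary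
  -- representative.
  rw [(hnet.heads 0).map_serviceDist_eq (hnet.heads i) 0 (x i), lintegral_map
    (f := fun d => ENNReal.ofReal (1 / (1 + interferenceCoeff η θ (x i) d)))
    (measurable_const.div (measurable_const.add
      ((measurable_interferenceCoeff η θ).comp measurable_prodMk_left))).ennreal_ofReal
    ((hnet.heads i).measurable_serviceDist (x i))]
  refine lintegral_congr fun ω => expNeg_negLog ?_
  have := interferenceCoeff_nonneg (η := η) hθ (x i)
    (serviceDist_nonneg (x i) fun j => Y i j ω)
  rw [ENNReal.ofReal_le_one]
  exact div_le_one_of_le₀ (by simpa using this) (by positivity)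

/-- The Laplace transform of the interference. -/
theorem lintegral_expNeg_interference (hnet : IsD2DNetwork P μ δ k X Y h h₀) {ρ η θ : ℝ}
    (hμ : 0 < μ) (hδ : 0 < δ) (hk : 0 < k) (hρ : 0 < ρ) (hη : 2 < η) (hθ : 0 < θ) :
    ∫⁻ ω, expNeg (ENNReal.ofReal (θ / ρ) *
      interference ρ η (fun i => X i ω) (fun i j => Y i j ω) (fun i => h i ω)) ∂P =
      expNeg (ENNReal.ofReal (2 / k *
        (θ * ∫ u in Ioi (1 : ℝ), u ^ (1 - η) / (1 + θ * u ^ (-η))))) := by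
  have hF : Measurable (Function.uncurry fun (x : ℕ → Plane) (q : (ℕ → ℕ → Plane) × (ℕ → ℝ)) =>
      expNeg (ENNReal.ofReal (θ / ρ) * interference ρ η x q.1 q.2)) :=
    measurable_expNeg.comp ((measurable_interference ρ η).const_mul _)
  refine (hnet.indep_members.lintegral_eq_lintegral_lintegral hnet.measurable_members
    (hnet.measurable_heads.prodMk hnet.measurable_gains) hF).trans ?_
  simp only [mul_interference_eq hρ hθ]
  simp_rw [hnet.lintegral_expNeg_heads_gains hθ]
  have hD := (hnet.heads 0).measurable_serviceDist 0
  set ν := P.map fun ω => serviceDist 0 fun j => Y 0 j ω with hνdef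
  have : IsProbabilityMeasure ν := Measure.isProbabilityMeasure_map hD.aemeasurable
  have hν : ∀ᵐ d ∂ν, 0 ≤ d := by
    rw [hνdef, ae_map_iff hD.aemeasurable measurableSet_Ici]
    exact .of_forall fun _ => serviceDist_nonneg _ _
  have hm : Measurable fun x : Plane =>
      ∫⁻ d, ENNReal.ofReal (1 / (1 + interferenceCoeff η θ x d)) ∂ν :=
    Measurable.lintegral_prod_right' (f := fun p : Plane × ℝ =>
      ENNReal.ofReal (1 / (1 + interferenceCoeff η θ p.1 p.2)))
      (measurable_const.div (measurable_const.add
        (measurable_interferenceCoeff η θ))).ennreal_ofReal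
  have : SigmaFinite (ENNReal.ofReal (δ * μ / k) • (volume : Measure Plane)) :=
    inferInstanceAs (SigmaFinite ((δ * μ / k).toNNReal • (volume : Measure Plane)))
  -- Choosing f as `negLog` of the mean over ν turns 1 - exp(-f) back into one minus that mean.
  rw [hnet.members.lintegral_expNeg_tsum
    (f := fun x => negLog (∫⁻ d, ENNReal.ofReal (1 / (1 + interferenceCoeff η θ x d)) ∂ν))
    (measurable_negLog.comp hm)]
  congr 1
  have hle : ∀ x, ∫⁻ d, ENNReal.ofReal (1 / (1 + interferenceCoeff η θ x d)) ∂ν ≤ 1 := by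
    intro x
    calc _ ≤ ∫⁻ _, 1 ∂ν := by
          refine lintegral_mono_ae ?_
          filter_upwards [hν] with d hd
          have := interferenceCoeff_nonneg (η := η) hθ x hd
          rw [ENNReal.ofReal_le_one]
          exact div_le_one_of_le₀ (by simpa using this) (by positivity)
      _ = 1 := by simp
  simp_rw [expNeg_negLog (hle _)]
  have hδμ : 0 < δ * μ := mul_pos hδ hμ
  have hk' : (0 : ℝ) < k := by exact_mod_cast hk
  -- The constants combine as (δμ/k) · 1/(δμπ) · 2π = 2/k.
  rw [lintegral_smul_measure, lintegral_one_sub_lintegral_interferenceCoeff hη hθ ν hν, hνdef,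
    lintegral_map (by fun_prop) hD, (hnet.heads 0).lintegral_serviceDist_sq hδμ 0, smul_eq_mul,
    ← ENNReal.ofReal_mul (by positivity), ← ENNReal.ofReal_mul (by positivity)]
  congr 1
  field_simp

theorem successProb_eq (hnet : IsD2DNetwork P μ δ k X Y h h₀) {ρ η θ N : ℝ}
    (hμ : 0 < μ) (hδ : 0 < δ) (hk : 0 < k) (hρ : 0 < ρ) (hη : 2 < η) (hθ : 0 < θ) (hN : 0 ≤ N) :
    successProb P ρ η N θ X Y h h₀ = Real.exp (-(N * θ / ρ) -
      2 / k * (θ * ∫ u in Ioi (1 : ℝ), u ^ (1 - η) / (1 + θ * u ^ (-η)))) := by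
  have hI : 0 ≤ ∫ u in Ioi (1 : ℝ), u ^ (1 - η) / (1 + θ * u ^ (-η)) :=
    setIntegral_nonneg measurableSet_Ioi fun u hu => by
      have hu0 : 0 < u := zero_lt_one.trans hu
      positivity
  have hm : Measurable fun ω => expNeg (ENNReal.ofReal (θ / ρ) *
      interference ρ η (fun i => X i ω) (fun i j => Y i j ω) (fun i => h i ω)) :=
    measurable_expNeg.comp <| ((measurable_interference ρ η).comp (hnet.measurable_members.prodMk
      (hnet.measurable_heads.prodMk hnet.measurable_gains))).const_mul _
  rw [successProb, measureReal_def, hnet.measure_lt_sinr hρ hθ]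
  simp_rw [mul_add, expNeg_add]
  rw [lintegral_const_mul _ hm, hnet.lintegral_expNeg_interference hμ hδ hk hρ hη hθ,
    ← ENNReal.ofReal_mul (by positivity), expNeg_ofReal (by positivity),
    expNeg_ofReal (by positivity), ← ENNReal.ofReal_mul (Real.exp_pos _).le, ← Real.exp_add,
    ENNReal.toReal_ofReal (Real.exp_pos _).le]
  congr 1
  ring

end IsD2DNetwork

theorem theorem3 {Ω : Type*} [MeasurableSpace Ω] (P : Measure Ω) [IsProbabilityMeasure P]
    (μ δ ρ η σ θ : ℝ) (k : ℕ) (hμ : 0 < μ) (hδ : 0 < δ) (hδ' : δ ≤ 1) (hk : 0 < k)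
    (hρ : 0 < ρ) (hη : 2 < η) (hθ : 0 < θ)
    (X : ℕ → Ω → Plane) (Y : ℕ → ℕ → Ω → Plane) (h : ℕ → Ω → ℝ) (h₀ : Ω → ℝ)
    (hnet : IsD2DNetwork P μ δ k X Y h h₀) :
    ((successProb P ρ η (σ ^ 2) θ X Y h h₀ : ℝ) : ℂ) =
        Complex.exp (-((σ ^ 2 * θ / ρ : ℝ) : ℂ) - ((2 * θ / (k * (η - 2)) : ℝ) : ℂ) *
          gaussHypergeometric 1 (1 - 2 / (η : ℂ)) (2 - 2 / (η : ℂ)) (-(θ : ℂ))) ∧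
      (η = 4 → successProb P ρ η (σ ^ 2) θ X Y h h₀ =
        Real.exp (-(σ ^ 2 * θ / ρ) - Real.sqrt θ / k * Real.arctan (Real.sqrt θ))) := by
  have hk' : (0 : ℝ) < k := by exact_mod_cast hk
  have hη' : 0 < η - 2 := by linarith
  rw [hnet.successProb_eq hμ hδ hk hρ hη hθ (sq_nonneg σ)]
  refine ⟨?_, ?_⟩
  · rw [gaussHypergeometric_neg_eq_integral hη hθ, ← Complex.ofReal_mul, ← Complex.ofReal_neg,
      ← Complex.ofReal_sub, ← Complex.ofReal_exp]
    congr 3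
    -- The factor η - 2 in the integral form of the hypergeometric function cancels the one in the
    -- denominator of the prefactor.
    field_simp
  · rintro rfl
    rw [integral_rpow_div_of_eq_four hθ]
    congr 2
    ring

end
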